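/- For a polynomial $f\in\mathbb{Q}[x]$, let $\operatorname{denom}(f)$ be the smallest positive integer $d$ such that $d\cdot f\in\mathbb{Z}[x]$. Let $B_n(x)=\sum_{k=0}^{n}\binom{n}{k}B_k\,x^{n-k}$ be the $n$th Bernoulli polynomial, where $B_k$ are the Bernoulli numbers, given by $\frac{t}{e^t-1}=\sum_{k\ge 0}B_k\frac{t^k}{k!}$ (so $B_1=-\tfrac12$). For $n\ge 1$ put $$\mathfrak{D}_n:=\operatorname{denom}\bigl(B_n(x)-B_n\bigr),\qquad \mathfrak{B}_n:=\operatorname{denom}\bigl(B_n(x)\bigr).$$ Then: 1. for every prime $p\ge 2$ there are infinitely many $n\ge 1$ with $\mathfrak{D}_n/\mathfrak{D}_{n+1}=p$; 2. there are infinitely many $n\ge 1$ with $\mathfrak{D}_n=\mathfrak{D}_{n+1}$; 3. for every prime $p\ge 3$ there are infinitely many $n\ge 1$ with $\mathfrak{B}_n/\mathfrak{B}_{n+1}=p$; 4. there are infinitely many $n\ge 1$ with $\mathfrak{B}_n=\mathfrak{B}_{n+1}$. -/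

import Mathlib

/-- `d` clears the denominators of `f`: it is a positive integer with `d · f ∈ ℤ[x]`. -/
def ClearsDenom (f : Polynomial ℚ) (d : ℕ) : Prop :=
  0 < d ∧ (d : ℚ) • f ∈ Polynomial.lifts (Int.castRingHom ℚ)

/-- Every rational polynomial has a positive integer clearing its denominators. -/
theorem exists_clearsDenom (f : Polynomial ℚ) : ∃ d : ℕ, ClearsDenom f d := by
  refine ⟨∏ i ∈ f.support, (f.coeff i).den,
    Finset.prod_pos fun i _ => (f.coeff i).den_pos, ?_⟩
  rw [Polynomial.lifts_iff_coeff_lifts]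
  intro k
  by_cases hk : k ∈ f.support
  · obtain ⟨c, hc⟩ := Finset.dvd_prod_of_mem (fun i => (f.coeff i).den) hk
    refine ⟨(c : ℤ) * (f.coeff k).num, ?_⟩
    rw [Polynomial.coeff_smul, hc, smul_eq_mul]
    have h := Rat.den_mul_eq_num (f.coeff k)
    simp only [eq_intCast]
    push_cast
    rw [← h]
    ring
  · refine ⟨0, ?_⟩
    simp [Polynomial.notMem_support_iff.mp hk]

open Classical in
/-- The denominator of `f ∈ ℚ[x]`: the smallest positive integer `d` with `d · f ∈ ℤ[x]`. -/
noncomputable def polyDenom (f : Polynomial ℚ) : ℕ :=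
  Nat.find (exists_clearsDenom f)

/-- The denominator of the polynomial `B_n(x) - B_n`. -/
noncomputable def denomD (n : ℕ) : ℕ :=
  polyDenom (Polynomial.bernoulli n - Polynomial.C (bernoulli n))

/-- The denominator of the Bernoulli polynomial `B_n(x)`. -/
noncomputable def denomB (n : ℕ) : ℕ :=
  polyDenom (Polynomial.bernoulli n)

/-! Write `s_q` for the base-`q` digit sum. Von Staudt–Clausen makes the coefficient denominators
squarefree, and Kummer's theorem tells when a binomial coefficient cancels a prime. Hence both
polynomial denominators are squarefree, and `q` divides `denomB n` iff `s_q(n) ≥ q - 1`, and `denomD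
n` iff `s_q(n) ≥ q` (`prime_dvd_denomB_iff`, `prime_dvd_denomD_iff`).

Pass from `n` to `n + 1`. If `q ∤ n + 1`, then `s_q` grows by one, and `s_q(n) ≡ n` mod `q - 1`
keeps it from crossing the threshold when `n` is odd (for `denomD`) or even and nonzero (for
`denomB`). So only primes dividing `n + 1` matter, and choosing `n + 1` as a prime power times a
small constant controls their digit sums. -/

/-! ### Digit sums -/

/-- The sum of the base-`p` digits of `n`. -/
def digitSum (p n : ℕ) : ℕ := (Nat.digits p n).sum

theorem digitSum_zero (p : ℕ) : digitSum p 0 = 0 := by simp [digitSum]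

theorem digitSum_add_mul {p : ℕ} (hp : 1 < p) {r : ℕ} (hr : r < p) (q : ℕ) :
    digitSum p (r + p * q) = r + digitSum p q := by
  by_cases h : r ≠ 0 ∨ q ≠ 0
  · simp [digitSum, Nat.digits_add p hp r q hr h]
  · push Not at h
    simp [digitSum, h.1, h.2]

theorem digitSum_of_lt {p : ℕ} (hp : 1 < p) {r : ℕ} (hr : r < p) : digitSum p r = r := by
  simpa [digitSum_zero] using digitSum_add_mul hp hr 0

theorem digitSum_eq_mod_add_div {p : ℕ} (hp : 1 < p) (n : ℕ) :
    digitSum p n = n % p + digitSum p (n / p) := by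
  conv_lhs => rw [← Nat.mod_add_div n p]
  exact digitSum_add_mul hp (Nat.mod_lt _ (by lia)) _

theorem digitSum_base_mul {p : ℕ} (hp : 1 < p) (n : ℕ) : digitSum p (p * n) = digitSum p n := by
  simpa using digitSum_add_mul hp (show 0 < p by lia) n

theorem digitSum_base_pow_mul {p : ℕ} (hp : 1 < p) (k n : ℕ) :
    digitSum p (p ^ k * n) = digitSum p n := by
  induction k with
  | zero => simp
  | succ k ih => rw [pow_succ', mul_assoc, digitSum_base_mul hp, ih]

theorem digitSum_pos {p : ℕ} (hp : 1 < p) {n : ℕ} (hn : n ≠ 0) : 0 < digitSum p n := by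
  induction n using Nat.strong_induction_on with
  | _ n ih =>
    rw [digitSum_eq_mod_add_div hp]
    rcases Nat.eq_zero_or_pos (n % p) with h | h
    · have hdiv : n / p ≠ 0 := fun h0 => hn (by rw [← Nat.mod_add_div n p, h, h0]; simp)
      have := ih _ (Nat.div_lt_self (by lia) hp) hdiv
      lia
    · lia

theorem two_le_digitSum {p : ℕ} (hp : 1 < p) {n : ℕ} (hn : p < n) (hpn : ¬ p ∣ n) :
    2 ≤ digitSum p n := by
  rw [digitSum_eq_mod_add_div hp]
  have h1 : n % p ≠ 0 := fun h => hpn (Nat.dvd_of_mod_eq_zero h)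
  have h2 := digitSum_pos hp (n := n / p) (Nat.div_pos hn.le (by lia)).ne'
  lia

/-- **Kummer's theorem**, without truncated subtraction. -/
theorem digitSum_add_digitSum {p : ℕ} (hp : p.Prime) (a b : ℕ) :
    digitSum p a + digitSum p b =
      digitSum p (a + b) + (p - 1) * padicValNat p ((a + b).choose a) := by
  have : Fact p.Prime := ⟨hp⟩
  rw [Nat.choose_symm_add]
  have h := congrArg (fun m => (p - 1) * padicValNat p m)
    (Nat.add_choose_mul_factorial_mul_factorial a b)
  have hc : (a + b).choose b ≠ 0 := (Nat.choose_pos (Nat.le_add_left b a)).ne'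
  simp only [padicValNat.mul (mul_ne_zero hc (Nat.factorial_ne_zero a)) (Nat.factorial_ne_zero b),
    padicValNat.mul hc (Nat.factorial_ne_zero a), mul_add, sub_one_mul_padicValNat_factorial] at h
  have ha := Nat.digit_sum_le p a
  have hb := Nat.digit_sum_le p b
  have hab := Nat.digit_sum_le p (a + b)
  unfold digitSum
  lia

theorem digitSum_add_eq_iff {p : ℕ} (hp : p.Prime) (a b : ℕ) :
    digitSum p a + digitSum p b = digitSum p (a + b) ↔ ¬ p ∣ (a + b).choose a := by
  have : Fact p.Prime := ⟨hp⟩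
  have hc : (a + b).choose a ≠ 0 := (Nat.choose_pos (Nat.le_add_right a b)).ne'
  rw [digitSum_add_digitSum hp, dvd_iff_padicValNat_ne_zero hc]
  have := hp.two_le
  simp
  lia

theorem digitSum_add_one {p : ℕ} (hp : p.Prime) (n : ℕ) :
    digitSum p n + 1 = digitSum p (n + 1) + (p - 1) * padicValNat p (n + 1) := by
  have h := digitSum_add_digitSum hp 1 n
  rw [digitSum_of_lt hp.one_lt hp.one_lt, add_comm 1 n, Nat.choose_one_right] at h
  lia

theorem digitSum_add_one_of_not_dvd {p : ℕ} (hp : p.Prime) {n : ℕ} (h : ¬ p ∣ n + 1) :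
    digitSum p (n + 1) = digitSum p n + 1 := by
  simpa [padicValNat.eq_zero_of_not_dvd h] using (digitSum_add_one hp n).symm

theorem digitSum_add_one_of_dvd {p : ℕ} (hp : p.Prime) {n : ℕ} (h : p ∣ n + 1) :
    digitSum p (n + 1) + (p - 1) ≤ digitSum p n + 1 := by
  have : Fact p.Prime := ⟨hp⟩
  rw [digitSum_add_one hp]
  have := one_le_padicValNat_of_dvd (Nat.succ_ne_zero n) h
  exact Nat.add_le_add_left (Nat.le_mul_of_pos_right _ this) _

/-- Legendre's formula: `n - s_p(n) = (p - 1) * v_p(n!)`. -/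
theorem digitSum_modEq {p : ℕ} (hp : p.Prime) (n : ℕ) : digitSum p n ≡ n [MOD p - 1] := by
  have : Fact p.Prime := ⟨hp⟩
  refine (Nat.modEq_iff_dvd' (Nat.digit_sum_le p n)).2 ⟨padicValNat p n.factorial, ?_⟩
  exact (sub_one_mul_padicValNat_factorial n).symm

theorem sub_one_le_digitSum {p : ℕ} (hp : p.Prime) {n : ℕ} (hn : n ≠ 0) (h : p - 1 ∣ n) :
    p - 1 ≤ digitSum p n :=
  Nat.le_of_dvd (digitSum_pos hp.one_lt hn) (((digitSum_modEq hp n).dvd_iff dvd_rfl).2 h)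

/-- A carry-free splitting: move digit units from `n` to `a`, lowest digit first, until `j` are
collected. -/
theorem exists_add_eq_digitSum_eq {p : ℕ} (hp : 1 < p) (n : ℕ) {j : ℕ} (hj : j ≤ digitSum p n) :
    ∃ a b, a + b = n ∧ digitSum p a = j ∧ digitSum p a + digitSum p b = digitSum p n := by
  induction n using Nat.strong_induction_on generalizing j with
  | _ n ih =>
    rcases Nat.eq_zero_or_pos n with rfl | hn
    · exact ⟨0, 0, rfl, by simp [digitSum_zero] at hj ⊢; lia, by simp [digitSum_zero]⟩
    have hs := digitSum_eq_mod_add_div hp n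
    have hr := Nat.mod_lt n (show p > 0 by lia)
    obtain ⟨a, b, hab, ha, hsum⟩ := ih (n / p) (Nat.div_lt_self hn hp)
      (j := j - min j (n % p)) (by lia)
    refine ⟨min j (n % p) + p * a, (n % p - min j (n % p)) + p * b, ?_, ?_, ?_⟩
    · calc _ = n % p + p * (a + b) := by rw [mul_add]; lia
        _ = n := by rw [hab, Nat.mod_add_div]
    · rw [digitSum_add_mul hp (by lia), ha]
      lia
    · rw [digitSum_add_mul hp (by lia), digitSum_add_mul hp (by lia), hs]
      lia

/-! ### Denominators of Bernoulli numbers -/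

theorem den_add_of_coprime {x y : ℚ} (h : x.den.Coprime y.den) :
    (x + y).den = x.den * y.den := by
  refine Nat.dvd_antisymm (Rat.add_den_dvd x y) (h.mul_dvd_of_dvd_of_dvd ?_ ?_)
  · have := Rat.sub_den_dvd (x + y) y
    rw [add_sub_cancel_right] at this
    exact h.dvd_of_dvd_mul_right this
  · have := Rat.sub_den_dvd (x + y) x
    rw [add_sub_cancel_left] at this
    exact h.symm.dvd_of_dvd_mul_right this

theorem den_sum_one_div_primes (S : Finset ℕ) (hS : ∀ p ∈ S, p.Prime) :
    (∑ p ∈ S, (1 : ℚ) / p).den = ∏ p ∈ S, p := by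
  classical
  induction S using Finset.induction_on with
  | empty => simp
  | insert a S ha ih =>
    have hap := hS a (Finset.mem_insert_self a S)
    have ih := ih fun p hp => hS p (Finset.mem_insert_of_mem hp)
    have hden : ((1 : ℚ) / a).den = a := by simp [hap.ne_zero]
    rw [Finset.sum_insert ha, Finset.prod_insert ha, den_add_of_coprime, hden, ih]
    rw [hden, ih]
    refine Nat.Coprime.prod_right fun q hq => ?_
    exact (Nat.coprime_primes hap (hS q (Finset.mem_insert_of_mem hq))).2
      (fun h => ha (h ▸ hq))

theorem den_bernoulli_two_mul (k : ℕ) :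
    (bernoulli (2 * k)).den =
      ∏ p ∈ Finset.range (2 * k + 2) with p.Prime ∧ (p - 1) ∣ 2 * k, p := by
  obtain ⟨z, hz⟩ := Bernoulli.vonStaudt_clausen k
  rw [← den_sum_one_div_primes _ fun p hp => (Finset.mem_filter.1 hp).2.1,
    show bernoulli (2 * k) = z - ∑ p ∈ Finset.range (2 * k + 2) with p.Prime ∧ (p - 1) ∣ 2 * k,
      (1 : ℚ) / p by rw [hz]; ring, Rat.intCast_sub_den]

theorem den_bernoulli_one : (bernoulli 1).den = 2 := by
  rw [bernoulli_one]
  norm_num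

theorem prime_dvd_den_bernoulli_two_mul {p : ℕ} (hp : p.Prime) (k : ℕ) :
    p ∣ (bernoulli (2 * k)).den ↔ k ≠ 0 ∧ p - 1 ∣ 2 * k := by
  rw [den_bernoulli_two_mul, hp.prime.dvd_finsetProd_iff]
  have h2 := hp.two_le
  constructor
  · rintro ⟨q, hq, hpq⟩
    simp only [Finset.mem_filter, Finset.mem_range] at hq
    rw [(Nat.prime_dvd_prime_iff_eq hp hq.2.1).1 hpq]
    exact ⟨by have := hq.2.1.two_le; lia, hq.2.2⟩
  · rintro ⟨hk, h⟩
    have := Nat.le_of_dvd (by lia) h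
    exact ⟨p, by simp only [Finset.mem_filter, Finset.mem_range]; exact ⟨by lia, hp, h⟩, dvd_rfl⟩

theorem den_bernoulli_of_odd {n : ℕ} (hn : Odd n) (h1 : n ≠ 1) : (bernoulli n).den = 1 := by
  rw [bernoulli_eq_zero_of_odd hn (by have := hn.pos; lia)]
  rfl

theorem squarefree_den_bernoulli (n : ℕ) : Squarefree (bernoulli n).den := by
  rcases Nat.even_or_odd' n with ⟨k, rfl | rfl⟩
  · rw [den_bernoulli_two_mul]
    refine Finset.squarefree_prod_of_pairwise_isCoprime (fun p hp q hq hpq => ?_) fun p hp => ?_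
    · exact Nat.coprime_iff_isRelPrime.1 ((Nat.coprime_primes (Finset.mem_filter.1 hp).2.1
        (Finset.mem_filter.1 hq).2.1).2 hpq)
    · exact (Finset.mem_filter.1 hp).2.1.prime.squarefree
  · rcases Nat.eq_zero_or_pos k with rfl | hk
    · rw [den_bernoulli_one]
      exact Nat.prime_two.prime.squarefree
    · rw [den_bernoulli_of_odd ⟨k, rfl⟩ (by lia)]
      exact squarefree_one

theorem sub_one_dvd_of_dvd_den_bernoulli {p n : ℕ} (hp : p.Prime) (h : p ∣ (bernoulli n).den) :
    n ≠ 0 ∧ p - 1 ∣ n := by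
  rcases Nat.even_or_odd' n with ⟨k, rfl | rfl⟩
  · have := (prime_dvd_den_bernoulli_two_mul hp k).1 h
    exact ⟨by lia, this.2⟩
  · rcases Nat.eq_zero_or_pos k with rfl | hk
    · rw [den_bernoulli_one] at h
      simp [(Nat.prime_dvd_prime_iff_eq hp Nat.prime_two).1 h]
    · rw [den_bernoulli_of_odd ⟨k, rfl⟩ (by lia)] at h
      exact absurd h hp.not_dvd_one

/-- The digit sum forces `p - 1 ∣ n`, so von Staudt–Clausen settles even `n`. Odd `n` forces `p =
2`, then `n = 1`. -/
theorem dvd_den_bernoulli_of_digitSum {p n : ℕ} (hp : p.Prime) (h : digitSum p n = p - 1) :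
    p ∣ (bernoulli n).den := by
  have h2 := hp.two_le
  have hdvd : p - 1 ∣ n := ((digitSum_modEq hp n).dvd_iff dvd_rfl).1 (h ▸ dvd_rfl)
  have hn : n ≠ 0 := by
    rintro rfl
    rw [digitSum_zero] at h
    lia
  rcases Nat.even_or_odd' n with ⟨k, rfl | rfl⟩
  · exact (prime_dvd_den_bernoulli_two_mul hp k).2 ⟨by lia, hdvd⟩
  · rcases hp.eq_two_or_odd' with rfl | hodd
    · rcases Nat.eq_zero_or_pos k with rfl | hk
      · rw [den_bernoulli_one]
      · have := two_le_digitSum one_lt_two (n := 2 * k + 1) (by lia) (by lia)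
        lia
    · obtain ⟨m, rfl⟩ := hodd
      obtain ⟨c, hc⟩ := hdvd
      have : 2 ∣ 2 * k + 1 := ⟨m * c, by rw [hc]; simp; ring⟩
      lia

/-! ### Denominators of rational polynomials -/

theorem den_dvd_iff_exists_mul_eq (q : ℚ) (d : ℕ) : q.den ∣ d ↔ ∃ z : ℤ, (z : ℚ) = d * q := by
  have hq : (q.den : ℚ) ≠ 0 := by exact_mod_cast q.den_ne_zero
  constructor
  · rintro ⟨c, rfl⟩
    refine ⟨c * q.num, ?_⟩
    push_cast
    rw [← Rat.den_mul_eq_num q]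
    ring
  · rintro ⟨z, hz⟩
    have h : (z * q.den : ℤ) = d * q.num := by
      have : (z : ℚ) * q.den = d * q.num := by
        rw [hz, ← Rat.den_mul_eq_num q]
        ring
      exact_mod_cast this
    have hcop : IsCoprime (q.den : ℤ) q.num := by
      rw [Int.isCoprime_iff_nat_coprime]
      simpa using q.reduced.symm
    exact_mod_cast hcop.dvd_of_dvd_mul_right (Dvd.intro_left z h)

theorem prime_dvd_den_mul_natCast_iff {p : ℕ} (hp : p.Prime) {q : ℚ} (hq : Squarefree q.den)
    (c : ℕ) : p ∣ (q * c).den ↔ p ∣ q.den ∧ ¬ p ∣ c := by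
  constructor
  · intro h
    have hpq : p ∣ q.den := h.trans (by simpa using Rat.mul_den_dvd q c)
    refine ⟨hpq, ?_⟩
    rintro ⟨c', rfl⟩
    obtain ⟨e, he⟩ := hpq
    have : (q * (p * c' : ℕ)).den ∣ e := by
      refine (den_dvd_iff_exists_mul_eq _ _).2 ⟨q.num * c', ?_⟩
      rw [Int.cast_mul, ← Rat.den_mul_eq_num q, he]
      push_cast
      ring
    exact (Nat.squarefree_iff_prime_squarefree.1 hq) p hp
      (he ▸ Nat.mul_dvd_mul_left p (h.trans this))
  · rintro ⟨hpq, hc⟩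
    obtain ⟨z, hz⟩ := (den_dvd_iff_exists_mul_eq (q * c) _).1 dvd_rfl
    have : q.den ∣ (q * c).den * c := by
      refine (den_dvd_iff_exists_mul_eq _ _).2 ⟨z, ?_⟩
      rw [hz]
      push_cast
      ring
    exact (hp.dvd_mul.1 (hpq.trans this)).resolve_right hc

theorem squarefree_den_mul_natCast {q : ℚ} (hq : Squarefree q.den) (c : ℕ) :
    Squarefree (q * c).den :=
  hq.squarefree_of_dvd (by simpa using Rat.mul_den_dvd q c)

theorem clearsDenom_iff (f : Polynomial ℚ) (d : ℕ) :
    ClearsDenom f d ↔ 0 < d ∧ ∀ i, (f.coeff i).den ∣ d := by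
  simp only [ClearsDenom, Polynomial.lifts_iff_coeff_lifts, den_dvd_iff_exists_mul_eq,
    Polynomial.coeff_smul, smul_eq_mul, Set.mem_range, eq_intCast]

theorem polyDenom_clearsDenom (f : Polynomial ℚ) : ClearsDenom f (polyDenom f) := by
  classical
  unfold polyDenom
  convert! Nat.find_spec (exists_clearsDenom f)

theorem polyDenom_le {f : Polynomial ℚ} {d : ℕ} (h : ClearsDenom f d) : polyDenom f ≤ d := by
  classical
  unfold polyDenom
  exact Nat.find_min' _ h

theorem polyDenom_pos (f : Polynomial ℚ) : 0 < polyDenom f := (polyDenom_clearsDenom f).1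

theorem den_coeff_dvd_polyDenom (f : Polynomial ℚ) (i : ℕ) : (f.coeff i).den ∣ polyDenom f :=
  ((clearsDenom_iff f _).1 (polyDenom_clearsDenom f)).2 i

theorem exists_not_dvd_of_mul_eq_polyDenom {f : Polynomial ℚ} {p m : ℕ} (hp : p.Prime)
    (h : polyDenom f = p * m) : ∃ i, ¬ (f.coeff i).den ∣ m := by
  by_contra! hm
  have hpos := polyDenom_pos f
  have hm0 : 0 < m := Nat.pos_of_ne_zero fun h0 => by simp [h, h0] at hpos
  have := polyDenom_le ((clearsDenom_iff f m).2 ⟨hm0, hm⟩)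
  have := hp.two_le
  nlinarith

theorem prime_dvd_polyDenom_iff {p : ℕ} (hp : p.Prime) (f : Polynomial ℚ) :
    p ∣ polyDenom f ↔ ∃ i, p ∣ (f.coeff i).den := by
  refine ⟨fun ⟨m, hm⟩ => ?_, fun ⟨i, hi⟩ => hi.trans (den_coeff_dvd_polyDenom f i)⟩
  obtain ⟨i, hi⟩ := exists_not_dvd_of_mul_eq_polyDenom hp hm
  refine ⟨i, ?_⟩
  by_contra h
  exact hi (((hp.coprime_iff_not_dvd.2 h).symm).dvd_of_dvd_mul_left
    (hm ▸ den_coeff_dvd_polyDenom f i))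

/-- If `p ^ 2` divided the denominator, removing one factor `p` would still clear every coefficient,
against minimality. -/
theorem squarefree_polyDenom {f : Polynomial ℚ} (hf : ∀ i, Squarefree (f.coeff i).den) :
    Squarefree (polyDenom f) := by
  refine Nat.squarefree_iff_prime_squarefree.2 fun p hp => ?_
  rintro ⟨m, hm⟩
  rw [mul_assoc] at hm
  obtain ⟨i, hi⟩ := exists_not_dvd_of_mul_eq_polyDenom hp hm
  apply hi
  have hd := den_coeff_dvd_polyDenom f i
  by_cases h : p ∣ (f.coeff i).den
  · obtain ⟨e, he⟩ := h
    have hpe : ¬ p ∣ e := fun h' =>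
      Nat.squarefree_iff_prime_squarefree.1 (hf i) p hp (he ▸ Nat.mul_dvd_mul_left p h')
    rw [he, hm] at hd
    rw [he]
    exact Nat.mul_dvd_mul_left p
      (((hp.coprime_iff_not_dvd.2 hpe).symm).dvd_of_dvd_mul_left
        (Nat.dvd_of_mul_dvd_mul_left hp.pos hd))
  · rw [hm] at hd
    exact ((hp.coprime_iff_not_dvd.2 h).symm).dvd_of_dvd_mul_left hd

/-! ### Denominators of Bernoulli polynomials -/

theorem coeff_bernoulli_of_le {n i : ℕ} (h : i ≤ n) :
    (Polynomial.bernoulli n).coeff i = bernoulli (n - i) * (n.choose i : ℕ) := by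
  rw [Polynomial.coeff_bernoulli, if_pos h]

theorem squarefree_den_coeff_bernoulli (n i : ℕ) :
    Squarefree ((Polynomial.bernoulli n).coeff i).den := by
  rw [Polynomial.coeff_bernoulli]
  split_ifs
  · exact squarefree_den_mul_natCast (squarefree_den_bernoulli _) _
  · exact squarefree_one

theorem coeff_bernoulli_sub_C (n i : ℕ) :
    (Polynomial.bernoulli n - Polynomial.C (bernoulli n)).coeff i =
      if i = 0 then 0 else (Polynomial.bernoulli n).coeff i := by
  rw [Polynomial.coeff_sub, Polynomial.coeff_C]
  split_ifs with h
  · simp [h, coeff_bernoulli_of_le]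
  · simp

theorem squarefree_denomB (n : ℕ) : Squarefree (denomB n) :=
  squarefree_polyDenom (squarefree_den_coeff_bernoulli n)

theorem squarefree_denomD (n : ℕ) : Squarefree (denomD n) := by
  refine squarefree_polyDenom fun i => ?_
  rw [coeff_bernoulli_sub_C]
  split_ifs
  · exact squarefree_one
  · exact squarefree_den_coeff_bernoulli n i

/-- The coefficient is a Bernoulli number times a binomial; `p` survives iff the binomial is prime
to `p`, i.e. adding `i` and `k` has no carry. -/
theorem prime_dvd_den_coeff_bernoulli_iff {p : ℕ} (hp : p.Prime) (i k : ℕ) :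
    p ∣ ((Polynomial.bernoulli (i + k)).coeff i).den ↔
      p ∣ (bernoulli k).den ∧ digitSum p i + digitSum p k = digitSum p (i + k) := by
  rw [coeff_bernoulli_of_le (Nat.le_add_right i k), Nat.add_sub_cancel_left,
    prime_dvd_den_mul_natCast_iff hp (squarefree_den_bernoulli k), digitSum_add_eq_iff hp]

theorem exists_add_of_prime_dvd_den_coeff {p n i : ℕ} (hp : p.Prime)
    (h : p ∣ ((Polynomial.bernoulli n).coeff i).den) :
    ∃ k, n = i + k ∧ p - 1 ≤ digitSum p k ∧ digitSum p i + digitSum p k = digitSum p n := by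
  have hin : i ≤ n := by
    by_contra hin
    rw [Polynomial.coeff_bernoulli, if_neg hin] at h
    exact hp.not_dvd_one h
  obtain ⟨k, rfl⟩ := Nat.exists_eq_add_of_le hin
  obtain ⟨h1, h2⟩ := (prime_dvd_den_coeff_bernoulli_iff hp i k).1 h
  obtain ⟨hk, hdvd⟩ := sub_one_dvd_of_dvd_den_bernoulli hp h1
  exact ⟨k, rfl, sub_one_le_digitSum hp hk hdvd, h2⟩

theorem exists_prime_dvd_den_coeff {p n : ℕ} (hp : p.Prime) (h : p - 1 ≤ digitSum p n) :
    ∃ i, digitSum p i + (p - 1) = digitSum p n ∧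
      p ∣ ((Polynomial.bernoulli n).coeff i).den := by
  obtain ⟨k, i, rfl, hk, hsum⟩ := exists_add_eq_digitSum_eq hp.one_lt n h
  refine ⟨i, by lia, ?_⟩
  rw [add_comm k i] at hsum ⊢
  exact (prime_dvd_den_coeff_bernoulli_iff hp i k).2
    ⟨dvd_den_bernoulli_of_digitSum hp hk, by lia⟩

theorem prime_dvd_denomB_iff {p : ℕ} (hp : p.Prime) (n : ℕ) :
    p ∣ denomB n ↔ p - 1 ≤ digitSum p n := by
  rw [denomB, prime_dvd_polyDenom_iff hp]
  constructor
  · rintro ⟨i, hi⟩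
    obtain ⟨k, -, hk, hsum⟩ := exists_add_of_prime_dvd_den_coeff hp hi
    lia
  · intro h
    obtain ⟨i, -, hi⟩ := exists_prime_dvd_den_coeff hp h
    exact ⟨i, hi⟩

/-- The threshold is one higher than for `denomB`: dropping the constant term requires `i ≠ 0`,
which uses up at least one digit unit. -/
theorem prime_dvd_denomD_iff {p : ℕ} (hp : p.Prime) (n : ℕ) :
    p ∣ denomD n ↔ p ≤ digitSum p n := by
  have h2 := hp.two_le
  rw [denomD, prime_dvd_polyDenom_iff hp]
  constructor
  · rintro ⟨i, hi⟩
    rw [coeff_bernoulli_sub_C] at hi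
    split_ifs at hi with h0
    · exact absurd hi hp.not_dvd_one
    · obtain ⟨k, -, hk, hsum⟩ := exists_add_of_prime_dvd_den_coeff hp hi
      have := digitSum_pos hp.one_lt h0
      lia
  · intro h
    obtain ⟨i, hsum, hi⟩ := exists_prime_dvd_den_coeff hp (n := n) (by lia)
    refine ⟨i, ?_⟩
    rw [coeff_bernoulli_sub_C, if_neg]
    · exact hi
    · rintro rfl
      rw [digitSum_zero] at hsum
      lia

/-! ### Consecutive denominators -/

theorem prime_dvd_denomD_iff_succ {n q : ℕ} (hq : q.Prime) (hn : Odd n) (h : ¬ q ∣ n + 1) :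
    q ∣ denomD n ↔ q ∣ denomD (n + 1) := by
  rw [prime_dvd_denomD_iff hq, prime_dvd_denomD_iff hq, digitSum_add_one_of_not_dvd hq h]
  have hq2 := hq.two_le
  refine ⟨fun h' => by lia, fun h' => ?_⟩
  by_contra hlt
  -- At the threshold `q - 1` divides the odd number `n`, so `q = 2`; but 2 divides `n + 1`.
  have hs : digitSum q n = q - 1 := by lia
  obtain ⟨c, hc⟩ : q - 1 ∣ n := ((digitSum_modEq hq n).dvd_iff dvd_rfl).1 (hs ▸ dvd_rfl)
  rcases hq.eq_two_or_odd' with rfl | ⟨m, rfl⟩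
  · obtain ⟨k, rfl⟩ := hn
    exact h ⟨k + 1, by ring⟩
  · rw [hc, Nat.odd_mul] at hn
    obtain ⟨t, ht⟩ := hn.1
    lia

theorem prime_dvd_denomD_of_succ {n q : ℕ} (hq : q.Prime) (h : q ∣ n + 1)
    (hs : 2 ≤ digitSum q (n + 1)) : q ∣ denomD n := by
  rw [prime_dvd_denomD_iff hq]
  have := digitSum_add_one_of_dvd hq h
  lia

theorem prime_dvd_denomB_iff_succ {n q : ℕ} (hq : q.Prime) (hn : Even n) (hn0 : n ≠ 0)
    (h : ¬ q ∣ n + 1) : q ∣ denomB n ↔ q ∣ denomB (n + 1) := by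
  rw [prime_dvd_denomB_iff hq, prime_dvd_denomB_iff hq]
  have hadd := digitSum_add_one_of_not_dvd hq h
  have hq2 := hq.two_le
  have hpos := digitSum_pos hq.one_lt hn0
  refine ⟨fun h' => by lia, fun h' => ?_⟩
  by_contra hlt
  have hs : digitSum q (n + 1) = q - 1 := by lia
  obtain ⟨c, hc⟩ : q - 1 ∣ n + 1 := ((digitSum_modEq hq (n + 1)).dvd_iff dvd_rfl).1 (hs ▸ dvd_rfl)
  rcases hq.eq_two_or_odd' with rfl | ⟨m, rfl⟩
  · lia
  · have hn1 := hn.add_one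
    rw [hc, Nat.odd_mul] at hn1
    obtain ⟨t, ht⟩ := hn1.1
    lia

theorem prime_dvd_denomB_of_dvd_succ {n q : ℕ} (hq : q.Prime) (h : q ∣ n + 1) :
    q ∣ denomB n := by
  rw [prime_dvd_denomB_iff hq]
  have := digitSum_add_one_of_dvd hq h
  have := digitSum_pos hq.one_lt (Nat.succ_ne_zero n)
  lia

theorem div_eq_of_squarefree {a b p : ℕ} (ha : Squarefree a) (hb : Squarefree b) (hp : p.Prime)
    (hpa : p ∣ a) (hpb : ¬ p ∣ b) (h : ∀ q, q.Prime → q ≠ p → (q ∣ a ↔ q ∣ b)) :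
    (a : ℚ) / b = p := by
  have hsq : Squarefree (p * b) :=
    (Nat.squarefree_mul (hp.coprime_iff_not_dvd.2 hpb)).2 ⟨hp.prime.squarefree, hb⟩
  have : a = p * b := by
    refine (Nat.Squarefree.ext_iff ha hsq).2 fun q hq => ?_
    rw [hq.dvd_mul, Nat.prime_dvd_prime_iff_eq hq hp]
    by_cases hqp : q = p
    · simp [hqp, hpa]
    · simp [hqp, h q hq hqp]
  have hb0 : (b : ℚ) ≠ 0 := by exact_mod_cast hb.ne_zero
  rw [this, Nat.cast_mul, mul_div_cancel_right₀ _ hb0]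

/-! ### Explicit families of `n` -/

theorem denomD_div_of_two_pow {n k : ℕ} (hn : n + 1 = 2 ^ (k + 2)) :
    (denomD n : ℚ) / denomD (n + 1) = 2 := by
  have hpow : 2 ^ (k + 2) = 2 * (2 * 2 ^ k) := by ring
  have hk : 0 < 2 ^ k := by positivity
  have hodd : Odd n := ⟨2 * 2 ^ k - 1, by lia⟩
  refine mod_cast div_eq_of_squarefree (squarefree_denomD n) (squarefree_denomD (n + 1))
    Nat.prime_two ?_ ?_ fun q hq hq2 => prime_dvd_denomD_iff_succ hq hodd fun h => hq2 ?_
  · rw [prime_dvd_denomD_iff Nat.prime_two]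
    -- The exponent must be at least 2 here: `n = 1` has binary digit sum 1.
    exact two_le_digitSum one_lt_two (by lia) (by lia)
  · rw [prime_dvd_denomD_iff Nat.prime_two, hn, ← mul_one (2 ^ (k + 2)),
      digitSum_base_pow_mul one_lt_two, digitSum_of_lt one_lt_two one_lt_two]
    norm_num
  · exact (Nat.prime_dvd_prime_iff_eq hq Nat.prime_two).1 (hq.dvd_of_dvd_pow (hn ▸ h))

theorem denomD_div_of_two_mul_pow {p n k : ℕ} (hp : p.Prime) (hp2 : p ≠ 2)
    (hn : n + 1 = p ^ (k + 1) * 2) : (denomD n : ℚ) / denomD (n + 1) = p := by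
  have hp3 : 2 < p := by have := hp.two_le; lia
  have hodd : Odd n := ⟨p ^ (k + 1) - 1, by have := pow_pos hp.pos (k + 1); lia⟩
  have hpn : p ∣ n + 1 := hn ▸ Dvd.dvd.mul_right (dvd_pow_self p (Nat.succ_ne_zero k)) 2
  have hsp : digitSum p (n + 1) = 2 := by
    rw [hn, digitSum_base_pow_mul hp.one_lt, digitSum_of_lt hp.one_lt hp3]
  have hs2 : 2 ≤ digitSum 2 (n + 1) := by
    rw [hn, mul_comm, digitSum_base_mul one_lt_two]
    refine two_le_digitSum one_lt_two (hp3.trans_le (Nat.le_self_pow (Nat.succ_ne_zero k) p))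
      fun h => hp2 ?_
    exact ((Nat.prime_dvd_prime_iff_eq Nat.prime_two hp).1
      (Nat.prime_two.dvd_of_dvd_pow h)).symm
  refine div_eq_of_squarefree (squarefree_denomD n) (squarefree_denomD (n + 1)) hp
    (prime_dvd_denomD_of_succ hp hpn hsp.ge) ?_ fun q hq hqp => ?_
  · rw [prime_dvd_denomD_iff hp]
    lia
  · by_cases hqn : q ∣ n + 1
    · obtain rfl : q = 2 := by
        rw [hn, hq.dvd_mul] at hqn
        rcases hqn with h | h
        · exact absurd ((Nat.prime_dvd_prime_iff_eq hq hp).1 (hq.dvd_of_dvd_pow h)) hqp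
        · exact (Nat.prime_dvd_prime_iff_eq hq Nat.prime_two).1 h
      exact iff_of_true (prime_dvd_denomD_of_succ hq hqn hs2)
        ((prime_dvd_denomD_iff hq _).2 hs2)
    · exact prime_dvd_denomD_iff_succ hq hodd hqn

theorem denomD_eq_succ {n k : ℕ} (hn : n + 1 = 3 ^ (k + 1) * 2 ^ 3) :
    denomD n = denomD (n + 1) := by
  have hpow : 3 ^ (k + 1) = 3 * 3 ^ k := by ring
  have hk : 0 < 3 ^ k := by positivity
  have hodd : Odd n := ⟨3 ^ (k + 1) * 4 - 1, by lia⟩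
  refine (Nat.Squarefree.ext_iff (squarefree_denomD n) (squarefree_denomD (n + 1))).2
    fun q hq => ?_
  by_cases hqn : q ∣ n + 1
  · have hs : q ≤ digitSum q (n + 1) := by
      rcases hq.dvd_mul.1 (hn ▸ hqn) with h | h
      · obtain rfl := (Nat.prime_dvd_prime_iff_eq hq Nat.prime_three).1 (hq.dvd_of_dvd_pow h)
        rw [hn, digitSum_base_pow_mul (by norm_num)]
        -- In base 3, `8 = 22` has digit sum 4, above the threshold 3.
        norm_num [digitSum]
      · obtain rfl := (Nat.prime_dvd_prime_iff_eq hq Nat.prime_two).1 (hq.dvd_of_dvd_pow h)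
        rw [hn, mul_comm, digitSum_base_pow_mul one_lt_two]
        refine two_le_digitSum one_lt_two (by lia) fun h => ?_
        exact absurd (Nat.prime_two.dvd_of_dvd_pow h) (by norm_num)
    exact iff_of_true (prime_dvd_denomD_of_succ hq hqn (hq.two_le.trans hs))
      ((prime_dvd_denomD_iff hq _).2 hs)
  · exact prime_dvd_denomD_iff_succ hq hodd hqn

theorem denomB_div_of_pow {p n k : ℕ} (hp : p.Prime) (hp3 : 3 ≤ p) (hn : n + 1 = p ^ (k + 1)) :
    (denomB n : ℚ) / denomB (n + 1) = p := by
  have hpn : p ∣ n + 1 := hn ▸ dvd_pow_self p (Nat.succ_ne_zero k)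
  have hle : p ≤ n + 1 := Nat.le_of_dvd (Nat.succ_pos n) hpn
  have heven : Even n := by
    have h : Odd (n + 1) := hn ▸ (hp.odd_of_ne_two (by lia)).pow
    simpa [parity_simps] using h
  refine div_eq_of_squarefree (squarefree_denomB n) (squarefree_denomB (n + 1)) hp
    (prime_dvd_denomB_of_dvd_succ hp hpn) ?_ fun q hq hqp =>
      prime_dvd_denomB_iff_succ hq heven (by lia) fun h => hqp ?_
  · rw [prime_dvd_denomB_iff hp, hn, ← mul_one (p ^ (k + 1)), digitSum_base_pow_mul hp.one_lt,
      digitSum_of_lt hp.one_lt hp.one_lt]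
    lia
  · exact (Nat.prime_dvd_prime_iff_eq hq hp).1 (hq.dvd_of_dvd_pow (hn ▸ h))

theorem denomB_eq_succ {n k : ℕ} (hn : n + 1 = 5 ^ (k + 1) * 3 ^ 2) :
    denomB n = denomB (n + 1) := by
  have hpow : 5 ^ (k + 1) = 5 * 5 ^ k := by ring
  have hk : 0 < 5 ^ k := by positivity
  have heven : Even n := by
    have h : Odd (n + 1) := by
      rw [hn]
      exact (Odd.pow (by decide)).mul (by decide)
    simpa [parity_simps] using h
  refine (Nat.Squarefree.ext_iff (squarefree_denomB n) (squarefree_denomB (n + 1))).2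
    fun q hq => ?_
  by_cases hqn : q ∣ n + 1
  · refine iff_of_true (prime_dvd_denomB_of_dvd_succ hq hqn) ((prime_dvd_denomB_iff hq _).2 ?_)
    rcases hq.dvd_mul.1 (hn ▸ hqn) with h | h
    · obtain rfl := (Nat.prime_dvd_prime_iff_eq hq Nat.prime_five).1 (hq.dvd_of_dvd_pow h)
      rw [hn, digitSum_base_pow_mul (by norm_num)]
      -- In base 5, `9 = 14` has digit sum 5, above the threshold 4.
      norm_num [digitSum]
    · obtain rfl := (Nat.prime_dvd_prime_iff_eq hq Nat.prime_three).1 (hq.dvd_of_dvd_pow h)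
      rw [hn, mul_comm, digitSum_base_pow_mul (by norm_num)]
      refine two_le_digitSum (by norm_num) (by lia) fun h => ?_
      exact absurd (Nat.prime_three.dvd_of_dvd_pow h) (by norm_num)
  · exact prime_dvd_denomB_iff_succ hq heven (by lia) hqn

/-- A set of positive naturals containing all `p ^ (k + r) * c - 1` is infinite. -/
theorem infinite_of_pow_mul_sub_one {P : ℕ → Prop} {p r c : ℕ} (hp : 1 < p) (hr : 0 < r)
    (hc : 0 < c) (h : ∀ n k, n + 1 = p ^ (k + r) * c → P n) : {n : ℕ | 1 ≤ n ∧ P n}.Infinite := by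
  refine Set.infinite_of_forall_exists_gt fun a => ?_
  have h1 : a + 1 + r < p ^ (a + 1 + r) := Nat.lt_pow_self hp
  have h2 : p ^ (a + 1 + r) ≤ p ^ (a + 1 + r) * c := Nat.le_mul_of_pos_right _ hc
  exact ⟨p ^ (a + 1 + r) * c - 1, ⟨by lia, h _ (a + 1) (by lia)⟩, by lia⟩

theorem corollary3 :
    (∀ p : ℕ, p.Prime →
      {n : ℕ | 1 ≤ n ∧ (denomD n : ℚ) / (denomD (n + 1) : ℚ) = (p : ℚ)}.Infinite) ∧
    {n : ℕ | 1 ≤ n ∧ denomD n = denomD (n + 1)}.Infinite ∧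
    (∀ p : ℕ, p.Prime → 3 ≤ p →
      {n : ℕ | 1 ≤ n ∧ (denomB n : ℚ) / (denomB (n + 1) : ℚ) = (p : ℚ)}.Infinite) ∧
    {n : ℕ | 1 ≤ n ∧ denomB n = denomB (n + 1)}.Infinite := by

  refine ⟨fun p hp => ?_, ?_, fun p hp hp3 => ?_, ?_⟩
  · by_cases hp2 : p = 2
    · subst hp2
      exact infinite_of_pow_mul_sub_one (p := 2) (r := 2) (c := 1) one_lt_two two_pos one_pos
        fun n k hn => denomD_div_of_two_pow (by simpa using hn)
    · exact infinite_of_pow_mul_sub_one (r := 1) hp.one_lt one_pos two_pos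
        fun n k hn => denomD_div_of_two_mul_pow hp hp2 hn
  · exact infinite_of_pow_mul_sub_one (p := 3) (r := 1) (c := 2 ^ 3) (by norm_num) one_pos
      (by norm_num) fun n k hn => denomD_eq_succ hn
  · exact infinite_of_pow_mul_sub_one (p := p) (r := 1) (c := 1) hp.one_lt one_pos one_pos
      fun n k hn => denomB_div_of_pow hp hp3 (by simpa using hn)
  · exact infinite_of_pow_mul_sub_one (p := 5) (r := 1) (c := 3 ^ 2) (by norm_num) one_pos
      (by norm_num) fun n k hn => denomB_eq_succ hn
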